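/- Let $Y$ be the set of all strictly increasing, continuous, transfinite sequences $x=(x_\alpha)_{\alpha\le\beta}$ of real numbers, where $0\le\beta<\omega_1$ (continuity being with respect to the order topology on $[0,\beta]$), ordered by declaring $x<y$ if and only if either $y$ strictly extends $x$, or there is an ordinal $\alpha$, at which both sequences are defined, such that $x_\xi=y_\xi$ for all $\xi<\alpha$ and $y_\alpha<x_\alpha$. A tree is a partially ordered set $(\Upsilon,\preccurlyeq)$ such that for each $t\in\Upsilon$ the set $(0,t]=\{s\in\Upsilon : s\preccurlyeq t\}$ is well-ordered, and such that every non-empty totally ordered subset of $\Upsilon$ has at most one minimal upper bound. Its order topology is generated by the sets $(s,t]=(0,t]\setminus(0,s]$, $s\prec t$, and the sets $(0,t]$, $t\in\Upsilon$. A topological space $X$ is a Gruenhage space if there are families $(\mathscr{U}_n)_{n\in\mathbb{N}}$ of open subsets of $X$ such that for all distinct $x,y\in X$ there exist $n\in\mathbb{N}$ and $U\in\mathscr{U}_n$ such that (1) $U\cap\{x,y\}$ is a singleton, and (2) $x$ lies in only finitely many $U'\in\mathscr{U}_n$ or $y$ lies in only finitely many $U'\in\mathscr{U}_n$. **Theorem.**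 Let $\Upsilon$ be a tree and suppose that there is a function $\rho\colon\Upsilon\to Y$ that is strictly increasing, i.e. $\rho(s)<\rho(t)$ whenever $s\prec t$. Then $\Upsilon$, with its order topology, is a Gruenhage space. -/

import Mathlib

open scoped Ordinal

/-- A topological space is a *Gruenhage space* if there are families `𝒰 0, 𝒰 1, …` of open sets
such that for any two distinct points `x`, `y` there are `n` and `U ∈ 𝒰 n` for which
`U ∩ {x, y}` is a singleton, and `x` or `y` lies in only finitely many members of `𝒰 n`. -/
def IsGruenhage (X : Type*) [TopologicalSpace X] : Prop :=
  ∃ 𝒰 : ℕ → Set (Set X),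
    (∀ n, ∀ U ∈ 𝒰 n, IsOpen U) ∧
    ∀ x y : X, x ≠ y → ∃ n, ∃ U ∈ 𝒰 n,
      (∃ z, U ∩ {x, y} = {z}) ∧
      ({U' | U' ∈ 𝒰 n ∧ x ∈ U'}.Finite ∨ {U' | U' ∈ 𝒰 n ∧ y ∈ U'}.Finite)

/-- A (Hausdorff) *tree*: a partially ordered set in which the set of predecessors `(0, t]` of
every element `t` is well-ordered, and every non-empty totally ordered subset has at most one
minimal upper bound. -/
structure IsHausdorffTree (T : Type*) [PartialOrder T] : Prop where
  wellOrdered : ∀ t : T, IsWellOrder (Set.Iic t) (· < ·)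
  hausdorff : ∀ C : Set T, C.Nonempty → IsChain (· ≤ ·) C →
    {u | Minimal (· ∈ upperBounds C) u}.Subsingleton

/-- The order topology of a tree, generated by the sets `(s, t]` with `s < t`, together with the
sets `(0, t] = {u | u ≤ t}`, where `0` is regarded as a point below all elements of the tree. (The
latter sets are needed only to make the minimal elements isolated points.) -/
@[reducible] def treeTopology (T : Type*) [PartialOrder T] : TopologicalSpace T :=
  TopologicalSpace.generateFrom
    ({A | ∃ s t : T, s < t ∧ A = Set.Iic t \ Set.Iic s} ∪ {A | ∃ t : T, A = Set.Iic t})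

/-- The set `Y` of all strictly increasing, continuous, transfinite sequences
`(x_α)_{α ≤ β}` of real numbers, where `0 ≤ β < ω₁`. Here `top` is the ordinal `β`, and continuity
is with respect to the order topology of the ordinal interval `[0, β]`. -/
structure SeqY where
  top : Ordinal.{0}
  top_lt : top < ω₁
  val : Set.Iic top → ℝ
  strictMono : StrictMono val
  continuous : Continuous val

namespace SeqY

/-- The strict order of `Y`: `x < y` iff `y` strictly extends `x`, or for some ordinal `α` (at
which both sequences are defined) `x_ξ = y_ξ` for all `ξ < α` and `y_α < x_α`. -/
instance : LT SeqY where
  lt x y :=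
    (∃ h : x.top < y.top, ∀ (ξ : Ordinal.{0}) (hξ : ξ ≤ x.top),
      x.val ⟨ξ, hξ⟩ = y.val ⟨ξ, hξ.trans h.le⟩) ∨
    (∃ (α : Ordinal.{0}) (hx : α ≤ x.top) (hy : α ≤ y.top),
      (∀ (ξ : Ordinal.{0}) (hξ : ξ < α),
        x.val ⟨ξ, hξ.le.trans hx⟩ = y.val ⟨ξ, hξ.le.trans hy⟩) ∧
      y.val ⟨α, hy⟩ < x.val ⟨α, hx⟩)

theorem lt_def (x y : SeqY) : x < y ↔
    (∃ h : x.top < y.top, ∀ (ξ : Ordinal.{0}) (hξ : ξ ≤ x.top),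
      x.val ⟨ξ, hξ⟩ = y.val ⟨ξ, hξ.trans h.le⟩) ∨
    (∃ (α : Ordinal.{0}) (hx : α ≤ x.top) (hy : α ≤ y.top),
      (∀ (ξ : Ordinal.{0}) (hξ : ξ < α),
        x.val ⟨ξ, hξ.le.trans hx⟩ = y.val ⟨ξ, hξ.le.trans hy⟩) ∧
      y.val ⟨α, hy⟩ < x.val ⟨α, hx⟩) := Iff.rfl

theorem lt_irrefl' (x : SeqY) : ¬ x < x := by
  rintro (⟨h, -⟩ | ⟨α, hx, hy, -, h⟩)
  · exact absurd h (lt_irrefl _)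
  · exact absurd h (lt_irrefl _)

theorem lt_trans' {x y z : SeqY} (hxy : x < y) (hyz : y < z) : x < z := by
  rcases hxy with ⟨h, e⟩ | ⟨α, hx, hy, e, l⟩ <;>
    rcases hyz with ⟨h', e'⟩ | ⟨β, hy', hz, e', l'⟩
  · exact Or.inl ⟨h.trans h', fun ξ hξ => (e ξ hξ).trans (e' ξ (hξ.trans h.le))⟩
  · by_cases hb : β ≤ x.top
    · refine Or.inr ⟨β, hb, hz, fun ξ hξ => (e ξ _).trans (e' ξ hξ), ?_⟩
      rw [e β hb]; exact l'
    · push Not at hb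
      exact Or.inl ⟨hb.trans_le hz, fun ξ hξ => (e ξ hξ).trans (e' ξ (hξ.trans_lt hb))⟩
  · refine Or.inr ⟨α, hx, hy.trans h'.le, fun ξ hξ => (e ξ hξ).trans (e' ξ _), ?_⟩
    rw [← e' α hy]; exact l
  · rcases lt_trichotomy α β with hab | rfl | hab
    · refine Or.inr ⟨α, hx, hab.le.trans hz, fun ξ hξ => (e ξ hξ).trans (e' ξ (hξ.trans hab)), ?_⟩
      rw [← e' α hab]; exact l
    · exact Or.inr ⟨α, hx, hz, fun ξ hξ => (e ξ hξ).trans (e' ξ hξ), l'.trans l⟩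
    · refine Or.inr ⟨β, hab.le.trans hx, hz, fun ξ hξ => (e ξ (hξ.trans hab)).trans (e' ξ hξ), ?_⟩
      rw [e β hab]; exact l'

theorem eq_of_forall {x y : SeqY} (h : x.top = y.top)
    (e : ∀ (ξ : Ordinal.{0}) (hx : ξ ≤ x.top) (hy : ξ ≤ y.top),
      x.val ⟨ξ, hx⟩ = y.val ⟨ξ, hy⟩) : x = y := by
  obtain ⟨a, ha, f, hf, hf'⟩ := x
  obtain ⟨b, hb, g, hg, hg'⟩ := y
  obtain rfl : a = b := h
  obtain rfl : f = g := funext fun ξ => e ξ.1 ξ.2 ξ.2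
  rfl

theorem trichotomy (x y : SeqY) : x < y ∨ x = y ∨ y < x := by
  by_cases h : ∃ (ξ : Ordinal.{0}) (hx : ξ ≤ x.top) (hy : ξ ≤ y.top),
      x.val ⟨ξ, hx⟩ ≠ y.val ⟨ξ, hy⟩
  · obtain ⟨α, ⟨hx, hy, hne⟩, hmin⟩ := WellFounded.has_min (wellFounded_lt (α := Ordinal.{0}))
      {ξ | ∃ (hx : ξ ≤ x.top) (hy : ξ ≤ y.top), x.val ⟨ξ, hx⟩ ≠ y.val ⟨ξ, hy⟩} h
    have e : ∀ (ξ : Ordinal.{0}) (hξ : ξ < α),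
        x.val ⟨ξ, hξ.le.trans hx⟩ = y.val ⟨ξ, hξ.le.trans hy⟩ := by
      intro ξ hξ
      by_contra hc
      exact hmin ξ ⟨_, _, hc⟩ hξ
    rcases lt_or_gt_of_ne hne with hl | hl
    · exact Or.inr (Or.inr (Or.inr ⟨α, hy, hx, fun ξ hξ => (e ξ hξ).symm, hl⟩))
    · exact Or.inl (Or.inr ⟨α, hx, hy, e, hl⟩)
  · push Not at h
    rcases lt_trichotomy x.top y.top with ht | ht | ht
    · exact Or.inl (Or.inl ⟨ht, fun ξ hξ => h ξ _ _⟩)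
    · exact Or.inr (Or.inl (eq_of_forall ht h))
    · exact Or.inr (Or.inr (Or.inl ⟨ht, fun ξ hξ => (h ξ _ _).symm⟩))

/-- `Y` is linearly ordered by `<`. -/
noncomputable instance : LinearOrder SeqY where
  lt := (· < ·)
  le x y := x < y ∨ x = y
  le_refl _ := Or.inr rfl
  le_trans x y z := by
    rintro (h | rfl) (h' | rfl)
    · exact Or.inl (lt_trans' h h')
    · exact Or.inl h
    · exact Or.inl h'
    · exact Or.inr rfl
  lt_iff_le_not_ge x y := by
    constructor
    · intro h
      refine ⟨Or.inl h, ?_⟩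
      rintro (h' | rfl)
      · exact lt_irrefl' x (lt_trans' h h')
      · exact lt_irrefl' _ h
    · rintro ⟨h | rfl, h'⟩
      · exact h
      · exact absurd (Or.inr rfl) h'
  le_antisymm x y := by
    rintro (h | rfl) (h' | h')
    · exact absurd (lt_trans' h h') (lt_irrefl' x)
    · exact h'.symm
    · rfl
    · rfl
  le_total x y := by
    rcases trichotomy x y with h | h | h
    · exact Or.inl (Or.inl h)
    · exact Or.inl (Or.inr h)
    · exact Or.inr (Or.inl h)
  toDecidableLE := Classical.decRel _

end SeqY

open Set
open scoped Topology

/-! Replace each `ρ t` by its range `K t`, a compact set of reals. If `s < t`, the least point of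
the symmetric difference of `K s` and `K t` exists and lies in `K t` (`SeqY.precEq_range_of_lt`).
Along a segment of the tree, a trace `K x ∩ Iic p` that has changed therefore never returns to an
earlier value. Closedness puts rationals on both sides of a first difference, so countably many
families suffice.

Comparable points are separated by components of the fibres of a trace, which are disjoint for fixed
`p`. Incomparable points `s`, `t` are separated by the cone of a minimal element, or else have a
greatest common predecessor `w`. In the latter case, on the way from `w` to `s` there is a first `u`
whose set meets some rational interval `(p, r]` missed by `K w` (`exists_isJump_le`). A
neighbourhood of `u` contains `s` but not `t`, and it is the only member of its family containing
`s` (`subsingleton_jumpNhds`). -/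

/-- `A` precedes or equals `B` when `A = B` or the least element of the symmetric difference of
`A` and `B` exists and lies in `B`. -/
def PrecEq (A B : Set ℝ) : Prop :=
  A = B ∨ ∃ a ∈ B, a ∉ A ∧ A ∩ Iio a = B ∩ Iio a

/-! ### Sets of reals compared at their least difference -/

namespace PrecEq

variable {A B C : Set ℝ} {p r : ℝ}

theorem mem_iff_of_inter_eq {D : Set ℝ} (h : A ∩ D = B ∩ D) {x : ℝ} (hx : x ∈ D) :
    x ∈ A ↔ x ∈ B := by
  have := Set.ext_iff.1 h x
  simpa [hx] using this

theorem antisymm (h : PrecEq A B) (h' : PrecEq B A) : A = B := by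
  rcases h with h | ⟨a, haB, haA, ha⟩
  · exact h
  rcases h' with h' | ⟨b, hbA, hbB, hb⟩
  · exact h'.symm
  rcases lt_trichotomy a b with hab | rfl | hab
  · exact absurd ((mem_iff_of_inter_eq hb (x := a) hab).1 haB) haA
  · exact absurd haB hbB
  · exact absurd ((mem_iff_of_inter_eq ha (x := b) hab).1 hbA) hbB

theorem inter_Iic (h : PrecEq A B) (p : ℝ) : PrecEq (A ∩ Iic p) (B ∩ Iic p) := by
  rcases h with rfl | ⟨a, haB, haA, ha⟩
  · exact Or.inl rfl
  rcases le_or_gt a p with hap | hap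
  · refine Or.inr ⟨a, ⟨haB, hap⟩, fun h => haA h.1, ?_⟩
    rw [inter_right_comm, ha, inter_right_comm]
  · left
    ext x
    simp only [mem_inter_iff, mem_Iic]
    exact and_congr_left fun hx => mem_iff_of_inter_eq ha (hx.trans_lt hap)

/-- Truncation preserves `PrecEq`, so antisymmetry squeezes the middle trace; this makes fibres of
traces order-convex. -/
theorem inter_Iic_eq_of_between (h : PrecEq A B) (h' : PrecEq B C)
    (hAC : A ∩ Iic p = C ∩ Iic p) : B ∩ Iic p = A ∩ Iic p :=
  (hAC ▸ h'.inter_Iic p).antisymm (h.inter_Iic p)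

/-- The least difference lies beyond `p` and belongs to `B`, hence lies beyond `r`. -/
theorem inter_Ioc_eq_empty (h : PrecEq A B) (hp : A ∩ Iic p = B ∩ Iic p)
    (hB : B ∩ Ioc p r = ∅) : A ∩ Ioc p r = ∅ := by
  rcases h with rfl | ⟨a, haB, haA, ha⟩
  · exact hB
  have hpa : p < a := by
    by_contra hc
    exact haA ((mem_iff_of_inter_eq hp (not_lt.1 hc)).2 haB)
  have hra : r < a := by
    by_contra hc
    exact Set.eq_empty_iff_forall_notMem.1 hB a ⟨haB, hpa, not_lt.1 hc⟩
  refine Set.eq_empty_iff_forall_notMem.2 fun x hx => ?_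
  exact Set.eq_empty_iff_forall_notMem.1 hB x
    ⟨(mem_iff_of_inter_eq ha (hx.2.2.trans_lt hra)).1 hx.1, hx.2⟩

end PrecEq

theorem inter_Iic_eq_of_Ioc_eq_empty {A B : Set ℝ} {p r : ℝ} (h : A ∩ Iic p = B ∩ Iic p)
    (hA : A ∩ Ioc p r = ∅) (hB : B ∩ Ioc p r = ∅) : A ∩ Iic r = B ∩ Iic r := by
  ext x
  simp only [mem_inter_iff, mem_Iic]
  refine and_congr_left fun hx => ?_
  rcases le_or_gt x p with hxp | hxp
  · exact PrecEq.mem_iff_of_inter_eq h hxp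
  · exact ⟨fun h => absurd ⟨h, hxp, hx⟩ (Set.eq_empty_iff_forall_notMem.1 hA x),
      fun h => absurd ⟨h, hxp, hx⟩ (Set.eq_empty_iff_forall_notMem.1 hB x)⟩

/-- A left neighbourhood of the least point of difference is disjoint from a closed set `A`. -/
theorem PrecEq.exists_rat {A B : Set ℝ} (hA : IsClosed A) (h : PrecEq A B) (hne : A ≠ B) :
    ∃ p : ℚ, A ∩ Iic (p : ℝ) = B ∩ Iic (p : ℝ) ∧
      ∃ c ∈ B, (p : ℝ) < c ∧ A ∩ Ioc (p : ℝ) c = ∅ := by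
  rcases h with h | ⟨a, haB, haA, ha⟩
  · exact absurd h hne
  obtain ⟨ε, hε, hb⟩ := Metric.isOpen_iff.1 hA.isOpen_compl a haA
  obtain ⟨p, hp, hpa⟩ := exists_rat_btwn (show a - ε < a by linarith)
  refine ⟨p, ?_, a, haB, hpa, ?_⟩
  · ext x
    simp only [mem_inter_iff, mem_Iic]
    exact and_congr_left fun hx => mem_iff_of_inter_eq ha (hx.trans_lt hpa)
  · refine Set.eq_empty_iff_forall_notMem.2 fun x hx => ?_
    refine hb (a := x) ?_ hx.1
    rw [Metric.mem_ball, Real.dist_eq, abs_lt]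
    constructor <;> linarith [hx.2.1, hx.2.2]

theorem exists_rat_ge_inter_Ioc_eq_empty {A : Set ℝ} (hA : IsClosed A) {p c : ℝ} (hpc : p < c)
    (h : A ∩ Ioc p c = ∅) : ∃ r : ℚ, c ≤ r ∧ A ∩ Ioc p (r : ℝ) = ∅ := by
  have hc : c ∉ A := fun hc => Set.eq_empty_iff_forall_notMem.1 h c ⟨hc, hpc, le_rfl⟩
  obtain ⟨ε, hε, hb⟩ := Metric.isOpen_iff.1 hA.isOpen_compl c hc
  obtain ⟨r, hr, hrc⟩ := exists_rat_btwn (show c < c + ε by linarith)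
  refine ⟨r, hr.le, Set.eq_empty_iff_forall_notMem.2 fun x hx => ?_⟩
  rcases le_or_gt x c with hxc | hxc
  · exact Set.eq_empty_iff_forall_notMem.1 h x ⟨hx.1, hx.2.1, hxc⟩
  · refine hb (a := x) ?_ hx.1
    rw [Metric.mem_ball, Real.dist_eq, abs_lt]
    constructor <;> linarith [hx.2.2]

/-! ### Ranges of the sequences in `Y` -/

namespace SeqY

theorem isClosed_range (x : SeqY) : IsClosed (range x.val) := by
  have : CompactSpace (Iic x.top) := by
    rw [← Icc_bot]
    exact isCompact_iff_compactSpace.1 isCompact_Icc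
  exact (isCompact_range x.continuous).isClosed

/-- The least difference is the first new value of `y` in the extension case, and `y_α` otherwise;
monotonicity turns bounds on values into bounds on indices. -/
theorem precEq_range_of_lt {x y : SeqY} (h : x < y) :
    PrecEq (range x.val) (range y.val) ∧ range x.val ≠ range y.val := by
  suffices H : ∃ a ∈ range y.val, a ∉ range x.val ∧ range x.val ∩ Iio a = range y.val ∩ Iio a by
    refine ⟨Or.inr H, fun he => ?_⟩
    obtain ⟨a, ha, ha', -⟩ := H
    exact ha' (he ▸ ha)
  rcases h with ⟨h, e⟩ | ⟨α, hx, hy, e, l⟩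
  · have hs : Order.succ x.top ≤ y.top := Order.succ_le_of_lt h
    refine ⟨_, ⟨⟨Order.succ x.top, hs⟩, rfl⟩, ?_, ?_⟩
    · rintro ⟨⟨ξ, hξ⟩, he⟩
      rw [e ξ hξ] at he
      have := congrArg Subtype.val (y.strictMono.injective he)
      exact (Order.lt_succ_of_le (mem_Iic.1 hξ)).ne this
    · ext b
      constructor
      · rintro ⟨⟨⟨ξ, hξ⟩, rfl⟩, hb⟩
        exact ⟨⟨⟨ξ, le_trans hξ h.le⟩, (e ξ hξ).symm⟩, hb⟩
      · rintro ⟨⟨⟨ξ, hξ⟩, rfl⟩, hb⟩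
        have hlt : ξ < Order.succ x.top := y.strictMono.lt_iff_lt.1 hb
        have hle := Order.le_of_lt_succ hlt
        exact ⟨⟨⟨ξ, hle⟩, e ξ hle⟩, hb⟩
  · refine ⟨_, ⟨⟨α, hy⟩, rfl⟩, ?_, ?_⟩
    · rintro ⟨⟨ξ, hξ⟩, he⟩
      rcases lt_or_ge ξ α with hlt | hge
      · rw [e ξ hlt] at he
        have := congrArg Subtype.val (y.strictMono.injective he)
        exact hlt.ne this
      · have : x.val ⟨α, hx⟩ ≤ x.val ⟨ξ, hξ⟩ := x.strictMono.monotone hge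
        linarith
    · ext b
      constructor
      · rintro ⟨⟨⟨ξ, hξ⟩, rfl⟩, hb⟩
        have hlt : ξ < α := by
          have hb' : x.val ⟨ξ, hξ⟩ < x.val ⟨α, hx⟩ := lt_trans hb l
          exact x.strictMono.lt_iff_lt.1 hb'
        exact ⟨⟨⟨ξ, hlt.le.trans hy⟩, (e ξ hlt).symm⟩, hb⟩
      · rintro ⟨⟨⟨ξ, hξ⟩, rfl⟩, hb⟩
        have hlt : ξ < α := y.strictMono.lt_iff_lt.1 hb
        exact ⟨⟨⟨ξ, hlt.le.trans hx⟩, e ξ hlt⟩, hb⟩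

end SeqY

/-- Countably many families of open sets indexed by any countable type witness that a space is
Gruenhage. -/
theorem IsGruenhage.of_countable {X ι : Type*} [TopologicalSpace X] [Countable ι] [Nonempty ι]
    (𝒰 : ι → Set (Set X)) (ho : ∀ i, ∀ U ∈ 𝒰 i, IsOpen U)
    (hs : ∀ x y : X, x ≠ y → ∃ i, ∃ U ∈ 𝒰 i, (x ∈ U ∧ y ∉ U ∨ y ∈ U ∧ x ∉ U) ∧
      ({U' | U' ∈ 𝒰 i ∧ x ∈ U'}.Subsingleton ∨ {U' | U' ∈ 𝒰 i ∧ y ∈ U'}.Subsingleton)) :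
    IsGruenhage X := by
  obtain ⟨f, hf⟩ := exists_surjective_nat ι
  refine ⟨fun n => 𝒰 (f n), fun n => ho _, fun x y hxy => ?_⟩
  obtain ⟨i, U, hU, hsep, hfin⟩ := hs x y hxy
  obtain ⟨n, rfl⟩ := hf i
  refine ⟨n, U, hU, ?_, hfin.imp Set.Subsingleton.finite Set.Subsingleton.finite⟩
  rcases hsep with ⟨h, h'⟩ | ⟨h, h'⟩
  · refine ⟨x, ?_⟩
    ext z
    simp only [mem_inter_iff, mem_insert_iff, mem_singleton_iff]
    constructor
    · rintro ⟨hz, rfl | rfl⟩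
      · rfl
      · exact absurd hz h'
    · rintro rfl
      exact ⟨h, Or.inl rfl⟩
  · refine ⟨y, ?_⟩
    ext z
    simp only [mem_inter_iff, mem_insert_iff, mem_singleton_iff]
    constructor
    · rintro ⟨hz, rfl | rfl⟩
      · exact absurd hz h'
      · rfl
    · rintro rfl
      exact ⟨h, Or.inr rfl⟩

/-! ### Order and topology of Hausdorff trees -/

namespace IsHausdorffTree

variable {T : Type*} [PartialOrder T]

theorem le_total_of_le (hT : IsHausdorffTree T) {x y t : T} (hx : x ≤ t) (hy : y ≤ t) :
    x ≤ y ∨ y ≤ x := by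
  have := hT.wellOrdered t
  rcases trichotomous_of (· < ·) (⟨x, hx⟩ : Iic t) ⟨y, hy⟩ with h | h | h
  · exact Or.inl (le_of_lt h)
  · exact Or.inl (congrArg Subtype.val h).le
  · exact Or.inr (le_of_lt h)

theorem exists_first (hT : IsHausdorffTree T) {P : T → Prop} {t : T} (ht : P t) :
    ∃ m ≤ t, P m ∧ ∀ x < m, ¬ P x := by
  have := hT.wellOrdered t
  have wf : WellFounded ((· < ·) : Iic t → Iic t → Prop) := IsWellFounded.wf
  obtain ⟨m, hm, hmin⟩ := wf.has_min {x | P x.1} ⟨⟨t, le_rfl⟩, ht⟩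
  exact ⟨m, m.2, hm, fun x hx hP => hmin ⟨x, hx.le.trans m.2⟩ hP hx⟩

theorem isOpen_of_forall (hT : IsHausdorffTree T) {U : Set T}
    (hU : ∀ y ∈ U, (∃ v < y, Ioc v y ⊆ U) ∨ IsMin y) : IsOpen[treeTopology T] U := by
  let _ := treeTopology T
  refine isOpen_iff_forall_mem_open.2 fun y hy => ?_
  rcases hU y hy with ⟨v, hv, h⟩ | h
  · refine ⟨Iic y \ Iic v, ?_, TopologicalSpace.isOpen_generateFrom_of_mem
      (Or.inl ⟨v, y, hv, rfl⟩), le_rfl, hv.not_ge⟩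
    rintro x ⟨hx, hxv⟩
    refine h ⟨lt_of_le_not_ge ?_ hxv, hx⟩
    exact (hT.le_total_of_le hv.le hx).resolve_right hxv
  · refine ⟨Iic y, ?_, TopologicalSpace.isOpen_generateFrom_of_mem (Or.inr ⟨y, rfl⟩), le_rfl⟩
    intro x hx
    rwa [le_antisymm hx (h hx)]

/-- Incomparable elements lie above distinct minimal elements or have a greatest common
predecessor. -/
theorem exists_meet (hT : IsHausdorffTree T) {s t : T} (hst : ¬ s ≤ t) (hts : ¬ t ≤ s) :
    (∃ m, IsMin m ∧ m ≤ s ∧ ¬ m ≤ t) ∨ ∃ w, w < s ∧ w < t ∧ ∀ x, x ≤ s → x ≤ t → x ≤ w := by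
  -- If the common predecessors have no maximum, the first point below `s` and not below `t` is a
  -- minimal upper bound of them.
  have key : ∀ s t : T, ¬ s ≤ t → (∀ w, w ≤ s → w ≤ t → ∃ x, x ≤ s ∧ x ≤ t ∧ ¬ x ≤ w) →
      ∃ m ≤ s, ¬ m ≤ t ∧ Minimal (· ∈ upperBounds {x | x ≤ s ∧ x ≤ t}) m := by
    intro s t hst hno
    obtain ⟨m, hms, hmt, hmin⟩ := hT.exists_first (P := fun x => ¬ x ≤ t) hst
    refine ⟨m, hms, hmt, ?_, ?_⟩
    · rintro x ⟨hxs, hxt⟩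
      exact (hT.le_total_of_le hxs hms).resolve_right fun h => hmt (h.trans hxt)
    · intro u hu hum
      by_contra hmu
      have hut : u ≤ t := not_not.1 (hmin u (lt_of_le_not_ge hum hmu))
      obtain ⟨x, hxs, hxt, hxu⟩ := hno u (hum.trans hms) hut
      exact hxu (hu ⟨hxs, hxt⟩)
  by_cases hw : ∃ w, w ≤ s ∧ w ≤ t ∧ ∀ x, x ≤ s → x ≤ t → x ≤ w
  · obtain ⟨w, hws, hwt, hw⟩ := hw
    refine Or.inr ⟨w, lt_of_le_of_ne hws ?_, lt_of_le_of_ne hwt ?_, hw⟩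
    · rintro rfl; exact hst hwt
    · rintro rfl; exact hts hws
  push Not at hw
  left
  obtain ⟨m, hms, hmt, hm⟩ := key s t hst hw
  refine ⟨m, ?_, hms, hmt⟩
  -- With no common predecessors every point is an upper bound, so `m` is minimal in the tree.
  -- Otherwise the two sides give two minimal upper bounds, which the Hausdorff condition
  -- identifies.
  rcases ({x | x ≤ s ∧ x ≤ t} : Set T).eq_empty_or_nonempty with he | hne
  · intro u hu
    exact hm.2 (by rw [he]; simp) hu
  · obtain ⟨m', hms', -, hm'⟩ := key t s hts fun w h h' => by
      obtain ⟨x, h1, h2, h3⟩ := hw w h' h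
      exact ⟨x, h2, h1, h3⟩
    have hsymm : {x | x ≤ t ∧ x ≤ s} = {x | x ≤ s ∧ x ≤ t} := by
      ext x; exact and_comm
    rw [hsymm] at hm'
    have := hT.hausdorff _ hne (fun a ha b hb _ => hT.le_total_of_le ha.1 hb.1) hm hm'
    exact absurd (this ▸ hms') hmt

end IsHausdorffTree

/-! ### The open families and their point-finiteness -/

section Families

variable {T : Type*} [PartialOrder T]

/-- The cones of the minimal elements. -/
def minCones (T : Type*) [PartialOrder T] : Set (Set T) :=
  {U | ∃ m : T, IsMin m ∧ U = Ici m}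

/-- The components of the fibres of `t ↦ K t ∩ Iic p`, without their least elements. -/
def fibreComponents (K : T → Set ℝ) (p : ℝ) : Set (Set T) :=
  {U | ∃ m : T, (∀ x < m, K x ∩ Iic p ≠ K m ∩ Iic p) ∧
    U = {x | m < x ∧ K x ∩ Iic p = K m ∩ Iic p}}

/-- `u` is a jump over `(p, r]` from `v`: on `[v, u)` the sets `K x` have the same trace on
`(-∞, p]` as `K u` and miss `(p, r]`, whereas `K u` meets `(p, r]`. -/
def IsJump (K : T → Set ℝ) (p r : ℝ) (v u : T) : Prop :=
  v < u ∧ (K u ∩ Ioc p r).Nonempty ∧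
    ∀ x, v ≤ x → x < u → K x ∩ Iic p = K u ∩ Iic p ∧ K x ∩ Ioc p r = ∅

/-- The open neighbourhood attached to a jump `u` from `v`. -/
def jumpNhd (K : T → Set ℝ) (p : ℝ) (v u : T) : Set T :=
  Ioo v u ∪ {x | u ≤ x ∧ K x ∩ Iic p = K u ∩ Iic p}

/-- One neighbourhood for every point that is a jump over `(p, r]`. -/
def jumpNhds (K : T → Set ℝ) (p r : ℝ) : Set (Set T) :=
  {U | ∃ (u : T) (h : ∃ v, IsJump K p r v u), U = jumpNhd K p h.choose u}

variable {K : T → Set ℝ} {p r : ℝ}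

theorem isOpen_of_mem_minCones (hT : IsHausdorffTree T) {U : Set T} (hU : U ∈ minCones T) :
    IsOpen[treeTopology T] U := by
  obtain ⟨m, hm, rfl⟩ := hU
  refine hT.isOpen_of_forall fun y (hy : m ≤ y) => ?_
  rcases hy.eq_or_lt with rfl | h
  · exact Or.inr hm
  · exact Or.inl ⟨m, h, fun x hx => hx.1.le⟩

theorem subsingleton_minCones (hT : IsHausdorffTree T) (s : T) :
    {U | U ∈ minCones T ∧ s ∈ U}.Subsingleton := by
  rintro _ ⟨⟨m, hm, rfl⟩, hs⟩ _ ⟨⟨m', hm', rfl⟩, hs'⟩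
  rcases hT.le_total_of_le (mem_Ici.1 hs) (mem_Ici.1 hs') with h | h
  · rw [le_antisymm h (hm' h)]
  · rw [le_antisymm h (hm h)]

/-- Dropping the least element `m` is what gives openness: by convexity of the fibre, `(m, y]` is a
neighbourhood of each remaining `y`. -/
theorem isOpen_of_mem_fibreComponents (hT : IsHausdorffTree T)
    (hK : ∀ s t, s ≤ t → PrecEq (K s) (K t)) {U : Set T} (hU : U ∈ fibreComponents K p) :
    IsOpen[treeTopology T] U := by
  obtain ⟨m, -, rfl⟩ := hU
  refine hT.isOpen_of_forall fun y hy => Or.inl ⟨m, hy.1, fun x hx => ⟨hx.1, ?_⟩⟩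
  exact (hK m x hx.1.le).inter_Iic_eq_of_between (hK x y hx.2) hy.2.symm

theorem subsingleton_fibreComponents (hT : IsHausdorffTree T) (s : T) :
    {U | U ∈ fibreComponents K p ∧ s ∈ U}.Subsingleton := by
  rintro _ ⟨⟨m, hm, rfl⟩, hs, he⟩ _ ⟨⟨m', hm', rfl⟩, hs', he'⟩
  have hmm : m = m' := by
    rcases hT.le_total_of_le hs.le hs'.le with h | h
    · by_contra hne
      exact hm' m (lt_of_le_of_ne h hne) (he.symm.trans he')
    · by_contra hne
      exact hm m' (lt_of_le_of_ne h (Ne.symm hne)) (he'.symm.trans he)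
  rw [hmm]

theorem isOpen_jumpNhd (hT : IsHausdorffTree T) (hK : ∀ s t, s ≤ t → PrecEq (K s) (K t))
    {v u : T} (h : v < u) : IsOpen[treeTopology T] (jumpNhd K p v u) := by
  refine hT.isOpen_of_forall fun y hy => Or.inl ?_
  rcases hy with hy | ⟨hy, he⟩
  · exact ⟨v, hy.1, fun x hx => Or.inl ⟨hx.1, hx.2.trans_lt hy.2⟩⟩
  rcases hy.eq_or_lt with rfl | hlt
  · refine ⟨v, h, fun x hx => ?_⟩
    rcases hx.2.eq_or_lt with rfl | hxu
    · exact Or.inr ⟨le_rfl, rfl⟩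
    · exact Or.inl ⟨hx.1, hxu⟩
  · refine ⟨u, hlt, fun x hx => Or.inr ⟨hx.1.le, ?_⟩⟩
    exact (hK u x hx.1.le).inter_Iic_eq_of_between (hK x y hx.2) he.symm

/-- If `u < u'`, some `x ≥ u` in `[v', u')` has `K x` missing `(p, r]`; then so does the earlier `K
u`, which is absurd. -/
theorem IsJump.not_lt (hT : IsHausdorffTree T) (hK : ∀ s t, s ≤ t → PrecEq (K s) (K t))
    {v u v' u' : T} (hu : IsJump K p r v u) (hu' : IsJump K p r v' u')
    (he : K u ∩ Iic p = K u' ∩ Iic p) : ¬ u < u' := by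
  intro hlt
  obtain ⟨x, hux, hvx, hxu⟩ : ∃ x, u ≤ x ∧ v' ≤ x ∧ x < u' := by
    rcases hT.le_total_of_le hlt.le hu'.1.le with h | h
    · exact ⟨v', h, le_rfl, hu'.1⟩
    · exact ⟨u, le_rfl, h, hlt⟩
  obtain ⟨h1, h2⟩ := hu'.2.2 x hvx hxu
  exact hu.2.1.ne_empty ((hK u x hux).inter_Ioc_eq_empty (he.trans h1.symm) h2)

/-- If `s` were in the lower part `(v', u')` of another neighbourhood, `K s` and hence `K u` would
miss `(p, r]`. So `s` lies over `u'` in the same fibre, and `IsJump.not_lt` forces `u' = u`. -/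
theorem subsingleton_jumpNhds (hT : IsHausdorffTree T)
    (hK : ∀ s t, s ≤ t → PrecEq (K s) (K t)) {v u s : T} (hu : IsJump K p r v u) (hus : u ≤ s)
    (he : K s ∩ Iic p = K u ∩ Iic p) : {U | U ∈ jumpNhds K p r ∧ s ∈ U}.Subsingleton := by
  have key : ∀ (u' : T) (h : ∃ v, IsJump K p r v u'), s ∈ jumpNhd K p h.choose u' → u' = u := by
    rintro u' h (hs | ⟨hu's, he'⟩)
    · obtain ⟨-, h2⟩ := h.choose_spec.2.2 s hs.1.le hs.2
      exact absurd ((hK u s hus).inter_Ioc_eq_empty he.symm h2) hu.2.1.ne_empty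
    · have h1 := IsJump.not_lt hT hK hu h.choose_spec (he.symm.trans he')
      have h2 := IsJump.not_lt hT hK h.choose_spec hu (he'.symm.trans he)
      rcases hT.le_total_of_le hus hu's with hle | hle
      · exact (hle.eq_or_lt.resolve_right h1).symm
      · exact hle.eq_or_lt.resolve_right h2
  rintro _ ⟨⟨u₁, h₁, rfl⟩, hs₁⟩ _ ⟨⟨u₂, h₂, rfl⟩, hs₂⟩
  obtain rfl := key u₁ h₁ hs₁
  obtain rfl := key u₂ h₂ hs₂
  rfl

/-! ### Separation of points -/

theorem exists_fibreComponent_separating (hT : IsHausdorffTree T)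
    (hK : ∀ s t, s ≤ t → PrecEq (K s) (K t)) (hcl : ∀ t, IsClosed (K t))
    {s t : T} (hst : s < t) (hne : K s ≠ K t) :
    ∃ q : ℚ, ∃ U ∈ fibreComponents K q, s ∈ U ∧ t ∉ U ∨ t ∈ U ∧ s ∉ U := by
  obtain ⟨p, hp, c, hcB, hpc, hc⟩ := (hK s t hst.le).exists_rat (hcl s) hne
  obtain ⟨r, hcr, hr⟩ := exists_rat_ge_inter_Ioc_eq_empty (hcl s) hpc hc
  obtain ⟨m, hms, hm, hmin⟩ := hT.exists_first
    (P := fun x => K x ∩ Iic (p : ℝ) = K s ∩ Iic (p : ℝ)) (t := s) rfl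
  -- If `s` is the bottom of its `p`-component, that component omits `s` and contains `t`. Otherwise
  -- raise the level to `r ≥ c`: `m < s` still has the trace of `s`, so `s` survives in its
  -- `r`-component, while `c` excludes `t`.
  rcases hms.eq_or_lt with rfl | hlt
  · exact ⟨p, _, ⟨m, hmin, rfl⟩, Or.inr ⟨⟨hst, hp.symm⟩, fun h => lt_irrefl _ h.1⟩⟩
  have hmr : K m ∩ Iic (r : ℝ) = K s ∩ Iic (r : ℝ) :=
    inter_Iic_eq_of_Ioc_eq_empty hm ((hK m s hms).inter_Ioc_eq_empty hm hr) hr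
  obtain ⟨n, hnm, hn, hnmin⟩ := hT.exists_first
    (P := fun x => K x ∩ Iic (r : ℝ) = K s ∩ Iic (r : ℝ)) hmr
  refine ⟨r, _, ⟨n, fun x hx h => hnmin x hx (h.trans hn), rfl⟩,
    Or.inl ⟨⟨hnm.trans_lt hlt, hn.symm⟩, fun h => ?_⟩⟩
  have hcs : c ∈ K s := (PrecEq.mem_iff_of_inter_eq (h.2.trans hn) (x := c) hcr).1 hcB
  exact Set.eq_empty_iff_forall_notMem.1 hr c ⟨hcs, hpc, hcr⟩

theorem exists_isJump_le (hT : IsHausdorffTree T)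
    (hK : ∀ s t, s ≤ t → PrecEq (K s) (K t)) (hcl : ∀ t, IsClosed (K t))
    {w s : T} (hws : w < s) (hne : K w ≠ K s) :
    ∃ p r : ℚ, ∃ u ≤ s, IsJump K p r w u ∧ K s ∩ Iic (p : ℝ) = K u ∩ Iic (p : ℝ) := by
  obtain ⟨p, hp, hs⟩ := (hK w s hws.le).exists_rat (hcl w) hne
  -- The upper end `c` is left free here, so that `r` can be chosen after `u`.
  obtain ⟨u, hus, ⟨hwu, c, hcu, hpc, hc⟩, hmin⟩ := hT.exists_first
    (P := fun x => w < x ∧ ∃ c ∈ K x, (p : ℝ) < c ∧ K w ∩ Ioc (p : ℝ) c = ∅) ⟨hws, hs⟩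
  obtain ⟨r, hcr, hr⟩ := exists_rat_ge_inter_Ioc_eq_empty (hcl w) hpc hc
  have hbetween : ∀ x, w ≤ x → x ≤ s → K x ∩ Iic (p : ℝ) = K w ∩ Iic (p : ℝ) := fun x h h' =>
    (hK w x h).inter_Iic_eq_of_between (hK x s h') hp
  have hu := hbetween u hwu.le hus
  refine ⟨p, r, u, hus, ⟨hwu, ⟨c, hcu, hpc, hcr⟩, fun x hwx hxu =>
    ⟨(hbetween x hwx (hxu.le.trans hus)).trans hu.symm, ?_⟩⟩, hp.symm.trans hu.symm⟩
  rcases hwx.eq_or_lt with rfl | hlt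
  · exact hr
  -- A point `d` of `K x` in `(p, r]` would make `x` an earlier candidate than `u`.
  refine Set.eq_empty_iff_forall_notMem.2 fun d hd => hmin x hxu ⟨hlt, d, hd.1, hd.2.1, ?_⟩
  exact Set.subset_eq_empty
    (inter_subset_inter_right _ (Ioc_subset_Ioc_right hd.2.2)) hr

/-- A tree that carries a family of closed sets of reals, strictly increasing for the order given
by the least point of difference, is Gruenhage. -/
theorem IsHausdorffTree.isGruenhage_of_precEq (hT : IsHausdorffTree T)
    (hlt : ∀ s t, s < t → PrecEq (K s) (K t) ∧ K s ≠ K t) (hcl : ∀ t, IsClosed (K t)) :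
    @IsGruenhage T (treeTopology T) := by
  let _ := treeTopology T
  have hK : ∀ s t, s ≤ t → PrecEq (K s) (K t) := by
    intro s t h
    rcases h.eq_or_lt with rfl | h
    · exact Or.inl rfl
    · exact (hlt s t h).1
  refine IsGruenhage.of_countable (ι := Unit ⊕ ℚ ⊕ ℚ × ℚ)
    (Sum.elim (fun _ => minCones T)
      (Sum.elim (fun p => fibreComponents K p) fun q => jumpNhds K q.1 q.2)) ?_ ?_
  · rintro (i | p | q) U hU
    · exact isOpen_of_mem_minCones hT hU
    · exact isOpen_of_mem_fibreComponents hT hK hU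
    · obtain ⟨u, h, rfl⟩ := hU
      exact isOpen_jumpNhd hT hK h.choose_spec.1
  · intro s t hne
    by_cases hst : s ≤ t
    · have h := lt_of_le_of_ne hst hne
      obtain ⟨q, U, hU, hs⟩ := exists_fibreComponent_separating hT hK hcl h (hlt s t h).2
      exact ⟨Sum.inr (Sum.inl q), U, hU, hs, Or.inl (subsingleton_fibreComponents hT s)⟩
    by_cases hts : t ≤ s
    · have h := lt_of_le_of_ne hts hne.symm
      obtain ⟨q, U, hU, hs⟩ := exists_fibreComponent_separating hT hK hcl h (hlt t s h).2
      exact ⟨Sum.inr (Sum.inl q), U, hU, hs.symm, Or.inl (subsingleton_fibreComponents hT s)⟩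
    rcases hT.exists_meet hst hts with ⟨m, hm, hms, hmt⟩ | ⟨w, hws, -, hw⟩
    · exact ⟨Sum.inl (), Ici m, ⟨m, hm, rfl⟩, Or.inl ⟨hms, hmt⟩,
        Or.inl (subsingleton_minCones hT s)⟩
    · obtain ⟨p, r, u, hus, hj, he⟩ := exists_isJump_le hT hK hcl hws (hlt w s hws).2
      have h : ∃ v, IsJump K p r v u := ⟨w, hj⟩
      refine ⟨Sum.inr (Sum.inr (p, r)), _, ⟨u, h, rfl⟩, Or.inl ⟨Or.inr ⟨hus, he⟩, ?_⟩,
        Or.inl (subsingleton_jumpNhds hT hK hj hus he)⟩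
      -- The lower end picked by choice need not be `w`, but only `u` matters: `t < u` gives `t ≤
      -- s`, and `u ≤ t` makes `u` a common predecessor above `w`.
      rintro (ht | ht)
      · exact hts (ht.2.le.trans hus)
      · exact (hw u hus ht.1).not_gt hj.1

end Families

/-- A Hausdorff tree that admits a strictly increasing function into `Y` is a Gruenhage space in
its order topology. -/
theorem theorem3p2 {Υ : Type*} [PartialOrder Υ] (hΥ : IsHausdorffTree Υ)
    (ρ : Υ → SeqY) (hρ : StrictMono ρ) :
    @IsGruenhage Υ (treeTopology Υ) :=
  hΥ.isGruenhage_of_precEq (K := fun t => range (ρ t).val)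
    (fun _ _ h => SeqY.precEq_range_of_lt (hρ h)) fun t => (ρ t).isClosed_range
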